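/- All graphs are simple. For a graph $G$, let $|G|$ be the geometric realization of $G$ as a simplicial $1$-complex. A drawing of $G$ is a continuous map $\phi\colon |G|\to\mathbb{S}^2$ to the $2$-dimensional sphere such that (a) if $v$ is a vertex and $\phi(v)=\phi(x)$ for some $x\in|G|$, then $x=v$; (b) only finitely many points $x\in\mathbb{S}^2$ satisfy $|\phi^{-1}(x)|\ge 2$; these are the crossings of $\phi$; (c) every crossing $x$ satisfies $|\phi^{-1}(x)|=2$, and the two points of $\phi^{-1}(x)$ are inner points of distinct edges, called the edges involved in $x$; (d) every crossing $x$ has an open neighbourhood $D$ such that for every open set $D'\subseteq D$ with $x\in D'$, for one of the edges involved in $x$, say $e$, with $f$ the other one, at least two connected components of $D'\setminus\phi(e)$ contain points of $\phi(f)$. Two edges cross if they are the edges involved in some crossing, and an edge is crossed if it crosses some edge. A $1$-drawing is a drawing in which every edge is involved in at most one crossing. A $1$-drawing $\phi$ of $G$ is rich if no two edges with a common endvertex cross, and for every pair $vw$, $xy$ of edges that cross, the induced subgraph $G[\{v,w,x,y\}]$ is isomorphic to $K_4$ and none of its edges other than $vw$ and $xy$ is crossed. Lemma. Let $\phi$ be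 a rich $1$-drawing of a graph $G$ with at least one crossing. If every edge of $G$ that is crossed with respect to $\phi$ is contained in at least four triangles of $G$, then $G$ has an induced subgraph isomorphic to $K_6$ or to $K_{2,2,2,2}$. -/

import Mathlib

noncomputable section

namespace GraphDrawing

universe u

variable {V : Type u}

/-- The points of the geometric realization `|G|` of the simplicial 1-complex of a graph `G`,
in barycentric coordinates: nonnegative, with sum `1`, and the support is the set of vertices
of a simplex, that is, a single vertex or the set of endvertices of an edge. -/
def Realization (G : SimpleGraph V) : Type u :=
  {p : V →₀ ℝ // (∀ v, 0 ≤ p v) ∧ ∑ v ∈ p.support, p v = 1 ∧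
    ((∃ v, p.support = {v}) ∨ ∃ e ∈ G.edgeSet, ∀ v, v ∈ p.support ↔ v ∈ e)}

variable {G : SimpleGraph V}

namespace Realization

/-- The vertices of `G` on which the point `p` of `|G|` has a nonzero coordinate. -/
def support (p : Realization G) : Finset V := p.1.support

/-- The point of `|G|` that is the vertex `v`. -/
def vertex (G : SimpleGraph V) (v : V) : Realization G :=
  ⟨Finsupp.single v 1, by
    classical
    refine ⟨fun w => ?_, ?_, Or.inl ⟨v, ?_⟩⟩
    · rw [Finsupp.single_apply]; split_ifs <;> norm_num
    · simp
    · simp⟩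

/-- The point `(1 - t) v + t w` on the edge `vw` of `|G|`. -/
def edgePoint {v w : V} (h : G.Adj v w) (t : unitInterval) : Realization G :=
  ⟨Finsupp.single v (1 - (t : ℝ)) + Finsupp.single w (t : ℝ), by
    classical
    have hne : v ≠ w := h.ne
    have ht0 : (0 : ℝ) ≤ t := t.2.1
    have ht1 : (t : ℝ) ≤ 1 := t.2.2
    refine ⟨fun u => ?_, ?_, ?_⟩
    · simp only [Finsupp.add_apply, Finsupp.single_apply]
      split_ifs <;> linarith
    · have hsub : (Finsupp.single v (1 - (t : ℝ)) + Finsupp.single w (t : ℝ)).support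
          ⊆ {v, w} := by
        intro u hu
        by_contra hcon
        simp only [Finset.mem_insert, Finset.mem_singleton, not_or] at hcon
        simp [Ne.symm hcon.1, Ne.symm hcon.2] at hu
      rw [Finset.sum_subset hsub (fun u _ hu => by simpa using hu), Finset.sum_pair hne]
      simp [hne, hne.symm]
    · by_cases h0 : (t : ℝ) = 0
      · left
        refine ⟨v, ?_⟩
        rw [h0]
        simp
      by_cases h1 : (t : ℝ) = 1
      · left
        refine ⟨w, ?_⟩
        rw [h1]
        simp
      right
      refine ⟨s(v, w), h, fun u => ?_⟩
      have h1' : (1 : ℝ) - t ≠ 0 := fun hh => h1 (by linarith)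
      simp only [Finsupp.mem_support_iff, Finsupp.add_apply, Finsupp.single_apply, Sym2.mem_iff]
      by_cases huv : u = v
      · subst huv; simp [hne.symm, h1']
      · by_cases huw : u = w
        · subst huw; simp [hne, h0]
        · simp [huv, huw, Ne.symm huv, Ne.symm huw]⟩

/-- The topology of the 1-complex `|G|` (the weak topology): a set is open if and only if its
preimage under the parametrization of every edge by the unit interval is open. -/
instance instTopologicalSpace : TopologicalSpace (Realization G) :=
  ⨆ (v : V) (w : V) (h : G.Adj v w), TopologicalSpace.coinduced (edgePoint h) inferInstance

/-- The closed edge `e` as a subset of `|G|` (including its two endvertices). -/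
def edge (G : SimpleGraph V) (e : Sym2 V) : Set (Realization G) :=
  {p | ∀ v ∈ p.support, v ∈ e}

/-- The inner points of the edge `e`. -/
def inner (G : SimpleGraph V) (e : Sym2 V) : Set (Realization G) :=
  {p | ∀ v, v ∈ p.support ↔ v ∈ e}

end Realization

/-- The 2-dimensional sphere. -/
abbrev Sphere2 : Type := Metric.sphere (0 : EuclideanSpace ℝ (Fin 3)) 1

/-- The crossings of `φ`: the points with at least two preimages. -/
def crossings (φ : Realization G → Sphere2) : Set Sphere2 :=
  {x | (φ ⁻¹' {x}).Nontrivial}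

/-- The edge `e` is involved in the crossing `x`. -/
def IsInvolved (φ : Realization G → Sphere2) (e : Sym2 V) (x : Sphere2) : Prop :=
  e ∈ G.edgeSet ∧ x ∈ crossings φ ∧ ∃ p ∈ Realization.inner G e, φ p = x

/-- `φ` is a drawing of `G` in the 2-sphere. -/
structure IsDrawing (φ : Realization G → Sphere2) : Prop where
  continuous : Continuous φ
  vertex_injective : ∀ (v : V) (p : Realization G),
    φ (Realization.vertex G v) = φ p → p = Realization.vertex G v
  finite_crossings : (crossings φ).Finite
  /-- A crossing has exactly two preimages, and they are inner points of distinct edges. -/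
  preimage_crossing : ∀ x ∈ crossings φ, ∃ e ∈ G.edgeSet, ∃ f ∈ G.edgeSet, e ≠ f ∧
    ∃ p ∈ Realization.inner G e, ∃ q ∈ Realization.inner G f, φ ⁻¹' {x} = {p, q}
  /-- In every sufficiently small neighbourhood `D'` of a crossing, removing the image of one of
  the two edges involved leaves points of the image of the other one in more than one
  component. -/
  crosses_properly : ∀ x ∈ crossings φ, ∃ D : Set Sphere2, IsOpen D ∧ x ∈ D ∧
    ∀ D' : Set Sphere2, IsOpen D' → D' ⊆ D → x ∈ D' →
      ∃ e f : Sym2 V, e ≠ f ∧ IsInvolved φ e x ∧ IsInvolved φ f x ∧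
        ∃ a ∈ (D' \ φ '' Realization.edge G e) ∩ φ '' Realization.edge G f,
        ∃ b ∈ (D' \ φ '' Realization.edge G e) ∩ φ '' Realization.edge G f,
          connectedComponentIn (D' \ φ '' Realization.edge G e) a ≠
            connectedComponentIn (D' \ φ '' Realization.edge G e) b

/-- The edges `e` and `f` cross with respect to `φ`. -/
def Crosses (φ : Realization G → Sphere2) (e f : Sym2 V) : Prop :=
  e ≠ f ∧ ∃ x, IsInvolved φ e x ∧ IsInvolved φ f x

/-- The edge `e` is crossed with respect to `φ`. -/
def IsCrossed (φ : Realization G → Sphere2) (e : Sym2 V) : Prop :=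
  ∃ f, Crosses φ e f

/-- `φ` is a `k`-drawing of `G`: a drawing in which no edge is involved in more than `k`
crossings. -/
def IsKDrawing (k : ℕ) (φ : Realization G → Sphere2) : Prop :=
  IsDrawing φ ∧ ∀ e ∈ G.edgeSet, {x | IsInvolved φ e x}.encard ≤ k

/-- No two adjacent edges (edges with a common endvertex) cross. -/
def IsSimple (φ : Realization G → Sphere2) : Prop :=
  ∀ e f : Sym2 V, Crosses φ e f → ¬ ∃ v, v ∈ e ∧ v ∈ f

/-- `φ` is simple and, whenever `e` and `f` cross, no other edge of the subgraph induced on the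
endvertices of `e` and `f` is crossed. -/
def IsQuasiRich (φ : Realization G → Sphere2) : Prop :=
  IsSimple φ ∧ ∀ e f : Sym2 V, Crosses φ e f →
    ∀ g ∈ G.edgeSet, (∀ v ∈ g, v ∈ e ∨ v ∈ f) → g ≠ e → g ≠ f → ¬ IsCrossed φ g

/-- `φ` is quasi-rich and, whenever `e` and `f` cross, the endvertices of `e` and `f` induce a
`K₄` in `G`. -/
def IsRich (φ : Realization G → Sphere2) : Prop :=
  IsQuasiRich φ ∧ ∀ e f : Sym2 V, Crosses φ e f →
    Nonempty (G.induce {v | v ∈ e ∨ v ∈ f} ≃g (⊤ : SimpleGraph (Fin 4)))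

/-- The (vertex sets of the) triangles of `G` that contain the edge `e`. -/
def trianglesThrough (G : SimpleGraph V) (e : Sym2 V) : Set (Finset V) :=
  {T | G.IsNClique 3 T ∧ ∀ v ∈ e, v ∈ T}

end GraphDrawing

end

/-! The topological input is that two closed curves on the sphere cannot cross exactly once. If `vw`
and `xy` cross and lie in disjoint triangles `vwa` and `xyc`, the images of the triangles would
otherwise meet only at this crossing. Then, near it, each curve runs in one component of the
complement of the other, against the requirement that edges cross properly. So one of `va`, `wa`
crosses one of `xc`, `yc` (`IsKDrawing.exists_crosses_of_triangles`). The analysis rests on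
Janiszewski's theorem (`janiszewski`), derived from Borsuk's criterion: a compact set fails to
separate `a` from `b` in the plane if `(z - b) / (z - a)` has a continuous logarithm on it.

The rest is combinatorial and uses only `IsRichCrossing`: each edge crosses at most one other,
crossing edges span a `K₄` whose other edges are uncrossed, and a crossed edge has a common
neighbour of its ends outside any three given vertices. Applying the triangle property to several
pairs of triangles forces further crossings, and each crossing yields adjacencies. If the four ends
of a crossing have a common neighbour, the outcome is `K₆` (`exists_K6`). Otherwise two common
neighbours of each crossing edge complete the four ends to `K_{2,2,2,2}` (`exists_K2222_aux`). -/

section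
open Set Filter Topology

/-! ### Separation in the plane through continuous logarithms: Borsuk and Janiszewski. -/

namespace PlaneSeparation

/-- `f` is a continuous branch on `K` of the logarithm of `(z - b) / (z - a)`. -/
def HasLogRatio (K : Set ℂ) (a b : ℂ) : Prop :=
  ∃ f : ℂ → ℂ, ContinuousOn f K ∧ ∀ z ∈ K, Complex.exp (f z) = (z - b) / (z - a)

/-- Two lifts through the covering `exp` agree on a connected set once they agree at one point. -/
theorem constOn_of_exp_eq {X : Type*} [TopologicalSpace X] {s : Set X} (hs : IsPreconnected s)
    {g : X → ℂ} (hg : ContinuousOn g s)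
    (he : ∀ x ∈ s, ∀ y ∈ s, Complex.exp (g x) = Complex.exp (g y)) {x y : X} (hx : x ∈ s)
    (hy : y ∈ s) : g x = g y :=
  Complex.isCoveringMap_exp.constOn_of_comp hs hg
    (fun x hx y hy => Subtype.ext (he x hx y hy)) hx hy

theorem exists_continuous_log {g : ℂ → ℂ} (hg : Continuous g) (h0 : ∀ z, g z ≠ 0) :
    ∃ h : ℂ → ℂ, Continuous h ∧ ∀ z, Complex.exp (h z) = g z := by
  obtain ⟨F, ⟨-, hF⟩, -⟩ := Complex.isCoveringMapOn_exp.existsUnique_continuousMap_lifts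
    (⟨g, hg⟩ : C(ℂ, ℂ)) (a₀ := 0) (Complex.exp_log (h0 0)) (fun a => h0 a)
  exact ⟨F, F.continuous, fun z => congrFun hF z⟩

theorem isPreconnected_norm_gt {R : ℝ} (hR : 0 < R) : IsPreconnected {z : ℂ | R < ‖z‖} := by
  have h : {z : ℂ | R < ‖z‖} = Complex.exp '' {w | Real.log R < w.re} := by
    ext z
    constructor
    · intro hz
      have hz0 : z ≠ 0 := norm_pos_iff.1 (hR.trans hz)
      refine ⟨Complex.log z, ?_, Complex.exp_log hz0⟩
      simpa [Complex.log_re] using Real.log_lt_log hR hz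
    · rintro ⟨w, hw, rfl⟩
      simpa [Complex.norm_exp] using (Real.log_lt_iff_lt_exp hR).1 hw
  rw [h]
  exact (convex_halfSpace_re_gt _).isPreconnected.image _ Complex.continuous_exp.continuousOn

theorem HasLogRatio.symm {K : Set ℂ} {a b : ℂ} (h : HasLogRatio K a b) : HasLogRatio K b a := by
  obtain ⟨f, hf, he⟩ := h
  exact ⟨fun z => -f z, hf.neg, fun z hz => by rw [Complex.exp_neg, he z hz, inv_div]⟩

theorem HasLogRatio.trans {K : Set ℂ} {a b c : ℂ} (hb : b ∉ K) (h : HasLogRatio K a b)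
    (h' : HasLogRatio K b c) : HasLogRatio K a c := by
  obtain ⟨f, hf, he⟩ := h
  obtain ⟨f', hf', he'⟩ := h'
  refine ⟨fun z => f z + f' z, hf.add hf', fun z hz => ?_⟩
  have : z - b ≠ 0 := sub_ne_zero.2 fun h => hb (h ▸ hz)
  rw [Complex.exp_add, he z hz, he' z hz, mul_comm, div_mul_div_cancel₀ this]

/-- The ratio is `1 + (a - b) / (z - a)`, which stays in the unit disc around `1`, so the principal
logarithm is continuous there. -/
theorem hasLogRatio_of_dist_lt {K : Set ℂ} {a b : ℂ} (h : ∀ z ∈ K, dist b a < dist z a) :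
    HasLogRatio K a b := by
  have hne : ∀ z ∈ K, z - a ≠ 0 := fun z hz => sub_ne_zero.2 fun hh => by
    have := h z hz
    rw [hh, dist_self] at this
    exact absurd this (not_lt.2 dist_nonneg)
  have hs : ∀ z ∈ K, (z - b) / (z - a) ∈ Complex.slitPlane := fun z hz => by
    have h1 : (z - b) / (z - a) = 1 + (a - b) / (z - a) := by
      field_simp [hne z hz]
      ring
    rw [h1]
    apply Complex.mem_slitPlane_of_norm_lt_one
    rw [norm_div, div_lt_one (norm_pos_iff.2 (hne z hz)), ← dist_eq_norm, ← dist_eq_norm,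
      dist_comm]
    exact h z hz
  refine ⟨fun z => Complex.log ((z - b) / (z - a)), ?_, fun z hz =>
    Complex.exp_log (Complex.slitPlane_ne_zero (hs z hz))⟩
  exact ContinuousOn.clog ((continuousOn_id.sub continuousOn_const).div
    (continuousOn_id.sub continuousOn_const) hne) hs

/-- Points in a connected subset of the complement of `K` have a logarithmic ratio on `K`. -/
theorem hasLogRatio_of_isPreconnected {K C : Set ℂ} (hK : IsClosed K) (hC : IsPreconnected C)
    (hCK : Disjoint C K) {a b : ℂ} (ha : a ∈ C) (hb : b ∈ C) : HasLogRatio K a b := by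
  refine hC.induction₂' (fun x y => HasLogRatio K x y) (fun x hx => ?_)
    (fun x y z _ hy _ h h' => h.trans (fun hyK => hCK.le_bot ⟨hy, hyK⟩) h') ha hb
  have hxK : x ∈ Kᶜ := fun h => hCK.le_bot ⟨hx, h⟩
  obtain ⟨ε, hε, hball⟩ := Metric.isOpen_iff.1 hK.isOpen_compl x hxK
  filter_upwards [mem_nhdsWithin_of_mem_nhds (Metric.ball_mem_nhds x hε)] with y hy
  have h : HasLogRatio K x y := hasLogRatio_of_dist_lt fun z hz =>
    (Metric.mem_ball.1 hy).trans_le (not_lt.1 fun h => hball h hz)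
  exact ⟨h, h.symm⟩

theorem frontier_connectedComponentIn_subset {X : Type*} [TopologicalSpace X]
    [LocallyConnectedSpace X] {U : Set X} (hU : IsOpen U) (a : X) :
    frontier (connectedComponentIn U a) ⊆ Uᶜ := by
  intro x hx hxU
  have hopen : IsOpen (connectedComponentIn U a) := hU.connectedComponentIn
  rw [hopen.frontier_eq] at hx
  obtain ⟨y, hy1, hy2⟩ := mem_closure_iff.1 hx.1 _ (hU.connectedComponentIn (x := x))
    (mem_connectedComponentIn hxU)
  exact hx.2 (by
    rw [connectedComponentIn_eq hy2, ← connectedComponentIn_eq hy1]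
    exact mem_connectedComponentIn hxU)

/-- A branch on `K` would extend by Tietze to the whole plane. Gluing `(z - b) * exp (g z)` on the
bounded component to `z - a` outside it then gives a zero-free continuous function on `ℂ`, which has
a global logarithm. On a large circle this function is `z - a`, whose winding number is `1`, a
contradiction. -/
theorem not_hasLogRatio_of_isBounded {K : Set ℂ} (hK : IsClosed K) {a b : ℂ} (ha : a ∉ K)
    (hbdd : Bornology.IsBounded (connectedComponentIn Kᶜ a))
    (hb : b ∉ connectedComponentIn Kᶜ a) : ¬ HasLogRatio K b a := by
  classical
  rintro ⟨f, hf, he⟩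
  -- At `z = b` the quotient is a division by zero, so equals `0`, which is not a value of `exp`.
  by_cases hbK : b ∈ K
  · have := he b hbK
    simp at this
  obtain ⟨g, hg⟩ := ContinuousMap.exists_restrict_eq hK
    (⟨K.domRestrict f, continuousOn_iff_continuous_domRestrict.1 hf⟩ : C(K, ℂ))
  have hgf : ∀ z ∈ K, g z = f z := fun z hz => congrArg (fun k : C(K, ℂ) => k ⟨z, hz⟩) hg
  set U := connectedComponentIn Kᶜ a with hU
  have haU : a ∈ U := mem_connectedComponentIn ha
  let F : ℂ → ℂ := U.piecewise (fun z => (z - b) * Complex.exp (g z)) (fun z => z - a)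
  have hF : Continuous F := by
    refine Continuous.piecewise (fun z hz => ?_)
      ((continuous_id.sub continuous_const).mul (Complex.continuous_exp.comp g.continuous))
      (continuous_id.sub continuous_const)
    have hzK : z ∈ K := by
      simpa using frontier_connectedComponentIn_subset hK.isOpen_compl a hz
    have hzb : z - b ≠ 0 := sub_ne_zero.2 fun h => hbK (h ▸ hzK)
    rw [hgf z hzK, he z hzK, mul_div_cancel₀ _ hzb]
  have hF0 : ∀ z, F z ≠ 0 := fun z => by
    by_cases hz : z ∈ U
    · simp only [F, piecewise_eq_of_mem _ _ _ hz]
      exact mul_ne_zero (sub_ne_zero.2 fun h => hb (h ▸ hz)) (Complex.exp_ne_zero _)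
    · simp only [F, piecewise_eq_of_notMem _ _ _ hz]
      exact sub_ne_zero.2 fun h => hz (h ▸ haU)
  obtain ⟨h, hh, hexp⟩ := exists_continuous_log hF hF0
  obtain ⟨r, hr⟩ := hbdd.subset_ball a
  have hr0 : 0 < r := by simpa using hr haU
  let c : ℝ → ℂ := fun θ => a + r * Complex.exp (θ * Complex.I)
  have hc : Continuous c := by fun_prop
  have hcF : ∀ θ, F (c θ) = r * Complex.exp (θ * Complex.I) := fun θ => by
    have : c θ ∉ U := fun hmem => by
      have := hr hmem
      simp [c, dist_eq_norm, Complex.norm_exp_ofReal_mul_I, abs_of_pos hr0] at this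
    simp [F, piecewise_eq_of_notMem _ _ _ this, c]
  have hconst := constOn_of_exp_eq (s := univ) isPreconnected_univ
    (g := fun θ : ℝ => h (c θ) - θ * Complex.I) (by fun_prop) (fun x _ y _ => by
      simp only [Complex.exp_sub, hexp, hcF]
      rw [mul_div_cancel_right₀ _ (Complex.exp_ne_zero _),
        mul_div_cancel_right₀ _ (Complex.exp_ne_zero _)])
    (mem_univ (0 : ℝ)) (mem_univ (2 * Real.pi))
  have hper : c (2 * Real.pi) = c 0 := by simp [c, Complex.exp_two_pi_mul_I]
  simp only [hper] at hconst
  have hpi : (Real.pi : ℂ) ≠ 0 := by exact_mod_cast Real.pi_ne_zero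
  have h2 : (2 * Real.pi * Complex.I : ℂ) = 0 := by
    simp only [Complex.ofReal_zero, zero_mul, sub_zero] at hconst
    push_cast at hconst
    linear_combination hconst
  simp [Complex.I_ne_zero, hpi] at h2

/-- Borsuk's separation criterion in the plane. -/
theorem mem_connectedComponentIn_of_hasLogRatio {K : Set ℂ} (hK : IsCompact K) {a b : ℂ}
    (ha : a ∉ K) (hb : b ∉ K) (h : HasLogRatio K a b) : b ∈ connectedComponentIn Kᶜ a := by
  by_contra hab
  have hba : a ∉ connectedComponentIn Kᶜ b := fun hmem => hab (by
    rw [← connectedComponentIn_eq hmem]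
    exact mem_connectedComponentIn hb)
  obtain ⟨R, hR0, hR⟩ : ∃ R : ℝ, 0 < R ∧ K ⊆ Metric.closedBall 0 R := by
    obtain ⟨R, hR⟩ := hK.isBounded.subset_closedBall (0 : ℂ)
    exact ⟨max R 1, by positivity, hR.trans (Metric.closedBall_subset_closedBall (le_max_left _ _))⟩
  have hout : {z : ℂ | R < ‖z‖} ⊆ Kᶜ := fun z hz hzK => by
    have := hR hzK
    simp only [Metric.mem_closedBall, dist_zero_right] at this
    exact absurd hz (not_lt.2 this)
  -- Every unbounded component contains the connected exterior of the disc around `K`, so there is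
  -- only one.
  have key : ∀ x, ¬ Bornology.IsBounded (connectedComponentIn Kᶜ x) →
      {z : ℂ | R < ‖z‖} ⊆ connectedComponentIn Kᶜ x := fun x hx => by
    obtain ⟨y, hy, hyR⟩ : ∃ y ∈ connectedComponentIn Kᶜ x, R < ‖y‖ := by
      by_contra! hcon
      exact hx ((Metric.isBounded_closedBall (x := (0 : ℂ)) (r := R)).subset fun y hy => by
        simpa using hcon y hy)
    rw [connectedComponentIn_eq hy]
    exact (isPreconnected_norm_gt hR0).subset_connectedComponentIn hyR hout
  by_cases h1 : Bornology.IsBounded (connectedComponentIn Kᶜ a)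
  · exact not_hasLogRatio_of_isBounded hK.isClosed ha h1 hab h.symm
  by_cases h2 : Bornology.IsBounded (connectedComponentIn Kᶜ b)
  · exact not_hasLogRatio_of_isBounded hK.isClosed hb h2 hba h
  have hz : ((R + 1 : ℝ) : ℂ) ∈ {z : ℂ | R < ‖z‖} := by
    simp only [mem_ofPred_eq, Complex.norm_real, Real.norm_eq_abs]
    rw [abs_of_pos (by positivity)]
    linarith
  apply hab
  rw [connectedComponentIn_eq (key a h1 hz), ← connectedComponentIn_eq (key b h2 hz)]
  exact mem_connectedComponentIn hb

/-- On the connected intersection the two branches differ by a constant period of `exp`; shifting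
one of them makes them glue. -/
theorem HasLogRatio.union {K₁ K₂ : Set ℂ} (h₁ : IsClosed K₁) (h₂ : IsClosed K₂)
    (hI : IsPreconnected (K₁ ∩ K₂)) {a b : ℂ} (hl₁ : HasLogRatio K₁ a b)
    (hl₂ : HasLogRatio K₂ a b) : HasLogRatio (K₁ ∪ K₂) a b := by
  classical
  obtain ⟨f₁, hf₁, he₁⟩ := hl₁
  obtain ⟨f₂, hf₂, he₂⟩ := hl₂
  obtain ⟨k, hk, hkI⟩ : ∃ k : ℂ, Complex.exp k = 1 ∧ ∀ z ∈ K₁ ∩ K₂, f₁ z = f₂ z + k := by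
    rcases (K₁ ∩ K₂).eq_empty_or_nonempty with h | ⟨w, hw⟩
    · exact ⟨0, by simp, fun z hz => by simp [h] at hz⟩
    have hone : ∀ z ∈ K₁ ∩ K₂, Complex.exp (f₁ z - f₂ z) = 1 := fun z hz => by
      rw [Complex.exp_sub, he₁ z hz.1, ← he₂ z hz.2, div_self (Complex.exp_ne_zero _)]
    refine ⟨f₁ w - f₂ w, hone w hw, fun z hz => ?_⟩
    have := constOn_of_exp_eq hI (g := fun z => f₁ z - f₂ z)
      ((hf₁.mono inter_subset_left).sub (hf₂.mono inter_subset_right))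
      (fun x hx y hy => (hone x hx).trans (hone y hy).symm) hz hw
    linear_combination this
  have e₁ : EqOn (K₁.piecewise f₁ fun z => f₂ z + k) f₁ K₁ := piecewise_eqOn _ _ _
  have e₂ : EqOn (K₁.piecewise f₁ fun z => f₂ z + k) (fun z => f₂ z + k) K₂ := fun z hz => by
    by_cases hz1 : z ∈ K₁
    · rw [e₁ hz1, hkI z ⟨hz1, hz⟩]
    · simp [piecewise_eq_of_notMem _ _ _ hz1]
  refine ⟨K₁.piecewise f₁ fun z => f₂ z + k,
    (hf₁.congr e₁).union_of_isClosed ((hf₂.add continuousOn_const).congr e₂) h₁ h₂, ?_⟩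
  rintro z (hz | hz)
  · rw [e₁ hz, he₁ z hz]
  · rw [e₂ hz, Complex.exp_add, hk, mul_one, he₂ z hz]

/-- Janiszewski's theorem: if two compact sets with connected intersection both fail to separate
`a` from `b`, then so does their union. -/
theorem janiszewski {K₁ K₂ C₁ C₂ : Set ℂ} (h₁ : IsCompact K₁) (h₂ : IsCompact K₂)
    (hI : IsPreconnected (K₁ ∩ K₂)) (hC₁ : IsPreconnected C₁) (hC₂ : IsPreconnected C₂)
    (hd₁ : Disjoint C₁ K₁) (hd₂ : Disjoint C₂ K₂) {a b : ℂ} (ha₁ : a ∈ C₁) (hb₁ : b ∈ C₁)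
    (ha₂ : a ∈ C₂) (hb₂ : b ∈ C₂) : b ∈ connectedComponentIn (K₁ ∪ K₂)ᶜ a := by
  have hn : ∀ x, x ∈ C₁ → x ∈ C₂ → x ∉ K₁ ∪ K₂ := fun x hx1 hx2 h =>
    h.elim (fun h => hd₁.le_bot ⟨hx1, h⟩) fun h => hd₂.le_bot ⟨hx2, h⟩
  exact mem_connectedComponentIn_of_hasLogRatio (h₁.union h₂) (hn a ha₁ ha₂) (hn b hb₁ hb₂)
    ((hasLogRatio_of_isPreconnected h₁.isClosed hC₁ hd₁ ha₁ hb₁).union h₁.isClosed h₂.isClosed hI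
      (hasLogRatio_of_isPreconnected h₂.isClosed hC₂ hd₂ ha₂ hb₂))

end PlaneSeparation

/-! ### Closed curves that meet in a single point. -/

namespace PlaneSeparation

/-- `A` is a compact set that looks like a closed curve through `p`: inside `A`, the point `p` has
arbitrarily small neighbourhoods whose complement in `A` is contained in a continuum
avoiding `p`. -/
structure IsLoopAt {X : Type*} [TopologicalSpace X] (A : Set X) (p : X) : Prop where
  isCompact : IsCompact A
  mem : p ∈ A
  exists_continuum : ∀ N ∈ 𝓝 p, ∃ R ⊆ A, IsCompact R ∧ IsPreconnected R ∧ p ∉ R ∧ A \ R ⊆ N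

namespace IsLoopAt

variable {X Y : Type*} [TopologicalSpace X] [TopologicalSpace Y] {A B : Set X} {p : X}

theorem isPreconnected_diff [T1Space X] (hA : IsLoopAt A p) : IsPreconnected (A \ {p}) := by
  refine isPreconnected_of_forall_pair fun x hx y hy => ?_
  obtain ⟨R, hRA, -, hR, hpR, hN⟩ := hA.exists_continuum ({x}ᶜ ∩ {y}ᶜ)
    (inter_mem (isOpen_compl_singleton.mem_nhds (Ne.symm hx.2))
      (isOpen_compl_singleton.mem_nhds (Ne.symm hy.2)))
  refine ⟨R, fun z hz => ⟨hRA hz, fun h => hpR (h ▸ hz)⟩, ?_, ?_, hR⟩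
  · by_contra h
    exact (hN ⟨hx.1, h⟩).1 rfl
  · by_contra h
    exact (hN ⟨hy.1, h⟩).2 rfl

theorem image (hA : IsLoopAt A p) {U : Set X} (hU : IsOpen U) (hAU : A ⊆ U) {f : X → Y}
    (hf : ContinuousOn f U) (hinj : InjOn f U) : IsLoopAt (f '' A) (f p) := by
  refine ⟨hA.isCompact.image_of_continuousOn (hf.mono hAU), mem_image_of_mem f hA.mem,
    fun N hN => ?_⟩
  obtain ⟨R, hRA, hRc, hR, hpR, hRN⟩ := hA.exists_continuum (f ⁻¹' N)
    ((hf.continuousAt (hU.mem_nhds (hAU hA.mem))).preimage_mem_nhds hN)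
  refine ⟨f '' R, image_mono hRA, hRc.image_of_continuousOn (hf.mono (hRA.trans hAU)),
    hR.image f (hf.mono (hRA.trans hAU)), ?_, ?_⟩
  · rintro ⟨x, hx, hxp⟩
    exact hpR (hinj (hAU (hRA hx)) (hAU hA.mem) hxp ▸ hx)
  · rintro _ ⟨⟨x, hx, rfl⟩, hxR⟩
    exact hRN ⟨hx, fun h => hxR (mem_image_of_mem f h)⟩

/-- Two loops in the plane that only meet at `p`: near `p`, the second one runs in a single
component of the complement of the first one in a given neighbourhood of `p`. -/
theorem exists_isOpen_isPreconnected {A B : Set ℂ} {p : ℂ} (hA : IsLoopAt A p)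
    (hB : IsLoopAt B p) (hAB : A ∩ B = {p}) {D : Set ℂ} (hD : IsOpen D) (hpD : p ∈ D) :
    ∃ N ∈ 𝓝 p, ∃ W ⊆ D \ A, IsOpen W ∧ IsPreconnected W ∧ (N ∩ B) \ {p} ⊆ W := by
  obtain ⟨r, hr, hrD⟩ := Metric.isOpen_iff.1 hD p hpD
  obtain ⟨R, hRA, hRc, hR, hpR, hRN⟩ := hA.exists_continuum _ (Metric.ball_mem_nhds p hr)
  obtain ⟨ε, hε, hεR⟩ := Metric.isOpen_iff.1 (Metric.isOpen_ball.inter hRc.isClosed.isOpen_compl) p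
    (⟨Metric.mem_ball_self hr, hpR⟩ : p ∈ Metric.ball p r ∩ Rᶜ)
  refine ⟨Metric.ball p ε, Metric.ball_mem_nhds p hε, ?_⟩
  rcases ((Metric.ball p ε ∩ B) \ {p}).eq_empty_or_nonempty with h | ⟨b, hb⟩
  · exact ⟨∅, empty_subset _, isOpen_empty, isPreconnected_empty, h.subset⟩
  refine ⟨connectedComponentIn (Metric.ball p r \ A) b,
    (connectedComponentIn_subset _ _).trans (sdiff_subset_sdiff_left hrD),
    (Metric.isOpen_ball.sdiff hA.isCompact.isClosed).connectedComponentIn,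
    isPreconnected_connectedComponentIn, fun c hc => ?_⟩
  have hBA : Disjoint (B \ {p}) A := disjoint_left.2 fun z hz hzA => hz.2 (hAB.subset ⟨hzA, hz.1⟩)
  -- The circle confines the component to the ball. Neither `A` nor the circle with `R` separates
  -- `b` from `c`: they are joined by `B \ {p}` and by the small ball. The intersection of these two
  -- compact sets is the connected set `R`, as `A` leaves the ball only along `R`.
  have hK : IsCompact (Metric.sphere p r ∪ R) := (isCompact_sphere p r).union hRc
  have hI : A ∩ (Metric.sphere p r ∪ R) = R := by
    refine Subset.antisymm ?_ fun z hz => ⟨hRA hz, Or.inr hz⟩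
    rintro z ⟨hzA, hz | hz⟩
    · by_contra hzR
      have h1 := hRN ⟨hzA, hzR⟩
      rw [Metric.mem_sphere] at hz
      rw [Metric.mem_ball, hz] at h1
      exact lt_irrefl _ h1
    · exact hz
  have hd : Disjoint (Metric.ball p ε) (Metric.sphere p r ∪ R) := by
    refine disjoint_left.2 ?_
    rintro z hz (hz' | hz')
    · have h1 := (hεR hz).1
      rw [Metric.mem_sphere] at hz'
      rw [Metric.mem_ball, hz'] at h1
      exact lt_irrefl _ h1
    · exact (hεR hz).2 hz'
  have hmem := janiszewski hA.isCompact hK (by rwa [hI]) hB.isPreconnected_diff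
    (convex_ball p ε).isPreconnected hBA hd (a := b) (b := c)
    ⟨hb.1.2, hb.2⟩ ⟨hc.1.2, hc.2⟩ hb.1.1 hc.1.1
  have hbK : b ∈ (A ∪ (Metric.sphere p r ∪ R))ᶜ := by
    rintro (h | h)
    · exact hBA.le_bot ⟨⟨hb.1.2, hb.2⟩, h⟩
    · exact hd.le_bot ⟨hb.1.1, h⟩
  have hsub := connectedComponentIn_subset (A ∪ (Metric.sphere p r ∪ R))ᶜ b
  have hball : connectedComponentIn (A ∪ (Metric.sphere p r ∪ R))ᶜ b ⊆ Metric.ball p r := by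
    refine isPreconnected_connectedComponentIn.subset_left_of_subset_union Metric.isOpen_ball
      (Metric.isClosed_closedBall (x := p) (ε := r)).isOpen_compl ?_ (fun z hz => ?_)
      ⟨b, mem_connectedComponentIn hbK, (hεR hb.1.1).1⟩
    · exact disjoint_compl_right_iff_subset.2 Metric.ball_subset_closedBall
    · by_contra hcon
      simp only [mem_union, Metric.mem_ball, mem_compl_iff, Metric.mem_closedBall, not_or,
        not_not, not_lt] at hcon
      exact hsub hz (Or.inr (Or.inl (le_antisymm hcon.2 hcon.1)))
  exact isPreconnected_connectedComponentIn.subset_connectedComponentIn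
    (mem_connectedComponentIn hbK)
    (show _ ⊆ Metric.ball p r \ A from fun z hz => ⟨hball hz, fun h => hsub hz (Or.inl h)⟩) hmem

end IsLoopAt

open GraphDrawing in
/-- Stereographic projection, as a homeomorphism of the punctured sphere onto the plane. -/
theorem exists_stereographic (q : Sphere2) : ∃ (f : Sphere2 → ℂ) (g : ℂ → Sphere2),
    ContinuousOn f {q}ᶜ ∧ Continuous g ∧ (∀ z, g z ≠ q) ∧ (∀ z, f (g z) = z) ∧
      ∀ x, x ≠ q → g (f x) = x := by
  have : Fact (Module.finrank ℝ (EuclideanSpace ℝ (Fin 3)) = 2 + 1) := ⟨by simp⟩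
  let σ := stereographic' 2 q
  let L := Complex.orthonormalBasisOneI.repr
  have hs : σ.source = {q}ᶜ := stereographic'_source q
  have ht : σ.target = univ := stereographic'_target q
  refine ⟨fun x => L.symm (σ x), fun z => σ.symm (L z), ?_, ?_, fun z => ?_, fun z => ?_,
    fun x hx => ?_⟩
  · exact L.symm.continuous.comp_continuousOn (hs ▸ σ.continuousOn)
  · have := σ.continuousOn_symm
    rw [ht, continuousOn_univ] at this
    exact this.comp L.continuous
  · have := σ.map_target (x := L z) (by simp [ht])
    rw [hs] at this
    exact this
  · simp [σ.right_inv (x := L z) (by simp [ht])]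
  · have : x ∈ σ.source := by rw [hs]; exact hx
    simp [σ.left_inv this]

namespace IsLoopAt

open GraphDrawing

/-- The sphere minus `p` is connected, so it is not covered by two closed sets that both meet it and
are disjoint there. The point found serves as a centre of stereographic projection. -/
theorem exists_notMem_union {A B : Set Sphere2} {p : Sphere2} (hA : IsLoopAt A p)
    (hB : IsLoopAt B p) (hAB : A ∩ B = {p}) (hA' : (A \ {p}).Nonempty)
    (hB' : (B \ {p}).Nonempty) : ∃ q, q ∉ A ∪ B := by
  by_contra! hcon
  obtain ⟨f, g, -, hg, hgp, -, hgf⟩ := exists_stereographic p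
  have hc : IsPreconnected ({p}ᶜ : Set Sphere2) := by
    have : ({p}ᶜ : Set Sphere2) = range g := by
      ext x
      exact ⟨fun hx => ⟨f x, hgf x hx⟩, by rintro ⟨z, rfl⟩; exact hgp z⟩
    rw [this]
    exact isPreconnected_range hg
  obtain ⟨a, ha, hap⟩ := hA'
  obtain ⟨b, hb, hbp⟩ := hB'
  obtain ⟨x, hx, hx'⟩ := isPreconnected_closed_iff.1 hc A B hA.isCompact.isClosed
    hB.isCompact.isClosed (fun x _ => hcon x) ⟨a, hap, ha⟩ ⟨b, hbp, hb⟩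
  exact hx (hAB.subset hx')

theorem exists_isOpen_isPreconnected_sphere {A B : Set Sphere2} {p : Sphere2}
    (hA : IsLoopAt A p) (hB : IsLoopAt B p) (hAB : A ∩ B = {p}) (hA' : (A \ {p}).Nonempty)
    (hB' : (B \ {p}).Nonempty) {D : Set Sphere2} (hD : IsOpen D) (hpD : p ∈ D) :
    ∃ N ∈ 𝓝 p, ∃ W ⊆ D \ A, IsOpen W ∧ IsPreconnected W ∧ (N ∩ B) \ {p} ⊆ W := by
  obtain ⟨q, hq⟩ := hA.exists_notMem_union hB hAB hA' hB'
  obtain ⟨f, g, hf, hg, hgq, hfg, hgf⟩ := exists_stereographic q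
  have hAq : A ⊆ {q}ᶜ := fun x hx h => hq (Or.inl (h ▸ hx))
  have hBq : B ⊆ {q}ᶜ := fun x hx h => hq (Or.inr (h ▸ hx))
  have hinj : InjOn f {q}ᶜ := fun x hx y hy h => by rw [← hgf x hx, ← hgf y hy, h]
  obtain ⟨N, hN, W, hWD, hWo, hW, hNW⟩ := (hA.image isOpen_compl_singleton hAq hf
    hinj).exists_isOpen_isPreconnected (hB.image isOpen_compl_singleton hBq hf hinj)
    (by rw [← hinj.image_inter hAq hBq, hAB, image_singleton]) (hD.preimage hg)
    (by rw [mem_preimage, hgf p (hAq hA.mem)]; exact hpD)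
  have hgW : g '' W = {q}ᶜ ∩ f ⁻¹' W := by
    ext x
    constructor
    · rintro ⟨z, hz, rfl⟩
      exact ⟨hgq z, by rwa [mem_preimage, hfg]⟩
    · rintro ⟨hx, hxW⟩
      exact ⟨f x, hxW, hgf x hx⟩
  refine ⟨f ⁻¹' N, (hf.continuousAt (isOpen_compl_singleton.mem_nhds
    (hAq hA.mem))).preimage_mem_nhds hN, g '' W, ?_, ?_, hW.image g hg.continuousOn, ?_⟩
  · rintro _ ⟨z, hz, rfl⟩
    exact ⟨(hWD hz).1, fun h => (hWD hz).2 ⟨g z, h, hfg z⟩⟩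
  · rw [hgW]
    exact hf.isOpen_inter_preimage isOpen_compl_singleton hWo
  · rintro x ⟨⟨hxN, hxB⟩, hxp⟩
    rw [hgW]
    refine ⟨hBq hxB, hNW ⟨⟨hxN, mem_image_of_mem f hxB⟩, fun h => hxp ?_⟩⟩
    exact hinj (hBq hxB) (hBq hB.mem) h

/-- Two closed curves in the sphere that only meet at `p` do not cross there. -/
theorem exists_nhd_not_crossing {A B : Set Sphere2} {p : Sphere2}
    (hA : IsLoopAt A p) (hB : IsLoopAt B p) (hAB : A ∩ B = {p}) (hA' : (A \ {p}).Nonempty)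
    (hB' : (B \ {p}).Nonempty) {D : Set Sphere2} (hD : IsOpen D) (hpD : p ∈ D) :
    ∃ D' ⊆ D, IsOpen D' ∧ p ∈ D' ∧
      (∃ W ⊆ D' \ A, IsPreconnected W ∧ (D' ∩ B) \ {p} ⊆ W) ∧
      ∃ W ⊆ D' \ B, IsPreconnected W ∧ (D' ∩ A) \ {p} ⊆ W := by
  obtain ⟨N, hN, W, hWD, hWo, hW, hNW⟩ :=
    hA.exists_isOpen_isPreconnected_sphere hB hAB hA' hB' hD hpD
  obtain ⟨N', hN', W', hWD', hWo', hW', hNW'⟩ :=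
    hB.exists_isOpen_isPreconnected_sphere hA (inter_comm A B ▸ hAB) hB' hA' hD hpD
  -- Both connected sets must lie in the same neighbourhood. Adding them is harmless: `W` misses `A`
  -- and `W'` misses `B`, so `W'` adds no point of `B` and `W` none of `A`.
  refine ⟨(interior N ∩ interior N' ∩ D) ∪ (W ∪ W'), ?_,
    ((isOpen_interior.inter isOpen_interior).inter hD).union (hWo.union hWo'),
    Or.inl ⟨⟨mem_interior_iff_mem_nhds.2 hN, mem_interior_iff_mem_nhds.2 hN'⟩, hpD⟩,
    ⟨W, fun x hx => ⟨Or.inr (Or.inl hx), (hWD hx).2⟩, hW, ?_⟩,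
    ⟨W', fun x hx => ⟨Or.inr (Or.inr hx), (hWD' hx).2⟩, hW', ?_⟩⟩
  · rintro x (hx | hx | hx)
    exacts [hx.2, (hWD hx).1, (hWD' hx).1]
  · rintro x ⟨⟨hx | hx | hx, hxB⟩, hxp⟩
    exacts [hNW ⟨⟨interior_subset hx.1.1, hxB⟩, hxp⟩, hx, absurd hxB (hWD' hx).2]
  · rintro x ⟨⟨hx | hx | hx, hxA⟩, hxp⟩
    exacts [hNW' ⟨⟨interior_subset hx.1.2, hxA⟩, hxp⟩, absurd hxA (hWD hx).2, hx]

end IsLoopAt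

end PlaneSeparation

/-! ### Edges and triangles in the geometric realization. -/

namespace GraphDrawing

open PlaneSeparation

universe u

variable {V : Type u} {G : SimpleGraph V}

namespace Realization

theorem continuous_edgePoint {v w : V} (h : G.Adj v w) : Continuous (edgePoint h) := by
  rw [continuous_iff_coinduced_le]
  exact le_iSup_of_le v (le_iSup_of_le w (le_iSup_of_le h le_rfl))

theorem mem_support_edgePoint {v w : V} (h : G.Adj v w) {t : unitInterval} {u : V}
    (hu : u ∈ (edgePoint h t).support) : u = v ∨ u = w := by
  classical
  by_contra! hcon
  simp [support, edgePoint, hcon.1.symm, hcon.2.symm] at hu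

theorem support_nonempty (p : Realization G) : p.support.Nonempty := by
  by_contra h
  rw [Finset.not_nonempty_iff_eq_empty] at h
  have := p.2.2.1
  rw [show p.1.support = ∅ from h] at this
  simp at this

theorem support_vertex (v : V) : (vertex G v).support = {v} := by
  classical
  exact Finsupp.support_single v one_ne_zero

theorem edgePoint_zero {v w : V} (h : G.Adj v w) : edgePoint h 0 = vertex G v :=
  Subtype.ext (by simp [edgePoint, vertex])

theorem edgePoint_one {v w : V} (h : G.Adj v w) : edgePoint h 1 = vertex G w :=
  Subtype.ext (by simp [edgePoint, vertex])

theorem edgePoint_injective {v w : V} (h : G.Adj v w) : Function.Injective (edgePoint h) := by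
  classical
  intro s t hst
  have := congrArg (fun p : Realization G => p.1 w) hst
  exact Subtype.ext (by simpa [edgePoint, Finsupp.single_apply, h.ne] using this)

theorem edge_eq_range {v w : V} (h : G.Adj v w) : edge G s(v, w) = range (edgePoint h) := by
  classical
  ext p
  constructor
  · intro hp
    have hsub : p.1.support ⊆ {v, w} := fun u hu => by simpa using hp u hu
    have hsum : p.1 v + p.1 w = 1 := by
      have := p.2.2.1
      rwa [Finset.sum_subset hsub (fun u _ hu => by simpa using hu), Finset.sum_pair h.ne] at this
    refine ⟨⟨p.1 w, p.2.1 w, by linarith [p.2.1 v]⟩, Subtype.ext (Finsupp.ext fun u => ?_)⟩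
    simp only [edgePoint, Finsupp.add_apply, Finsupp.single_apply]
    by_cases huv : u = v
    · subst huv
      simp [h.ne.symm, ← hsum]
    by_cases huw : u = w
    · subst huw
      simp [h.ne]
    have : p.1 u = 0 := by
      by_contra hne
      have := hsub (Finsupp.mem_support_iff.2 hne)
      simp [huv, huw] at this
    simp [Ne.symm huv, Ne.symm huw, this]
  · rintro ⟨t, rfl⟩ u hu
    simpa using mem_support_edgePoint h hu

theorem inner_subset_edge (e : Sym2 V) : inner G e ⊆ edge G e := fun _ hp v hv => (hp v).1 hv

theorem eq_of_mem_inner {e f : Sym2 V} {p : Realization G} (he : p ∈ inner G e)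
    (hf : p ∈ inner G f) : e = f :=
  Sym2.ext fun v => (he v).symm.trans (hf v)

theorem eq_of_mem_inner_of_mem_edge {e f : Sym2 V} (heG : e ∈ G.edgeSet) {p : Realization G}
    (he : p ∈ inner G e) (hf : p ∈ edge G f) : e = f := by
  induction e with | _ x y => ?_
  have hne : x ≠ y := G.ne_of_adj heG
  have hx := hf x ((he x).2 (Sym2.mem_mk_left x y))
  have hy := hf y ((he y).2 (Sym2.mem_mk_right x y))
  exact ((Sym2.mem_and_mem_iff hne).1 ⟨hx, hy⟩).symm

/-- The closed curve in `|G|` formed by the edges of a triangle. -/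
def triangle (G : SimpleGraph V) (v w a : V) : Set (Realization G) :=
  edge G s(v, w) ∪ edge G s(w, a) ∪ edge G s(v, a)

theorem mem_of_mem_triangle {v w a u : V} {p : Realization G} (hp : p ∈ triangle G v w a)
    (hu : u ∈ p.support) : u = v ∨ u = w ∨ u = a := by
  rcases hp with (hp | hp) | hp <;> have := hp u hu <;> simp at this <;> tauto

theorem vertex_mem_triangle (v w a : V) : vertex G v ∈ triangle G v w a := by
  refine Or.inl (Or.inl fun u hu => ?_)
  rw [support_vertex, Finset.mem_singleton] at hu
  simp [hu]

end Realization

open Realization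

/-- Deleting a short open interval around `P` from the triangle leaves an arc. Only the value at `P`
has to be attained once; the image may meet itself elsewhere. -/
theorem isLoopAt_image_triangle {φ : Realization G → Sphere2} (hφ : Continuous φ) {v w a : V}
    (hvw : G.Adj v w) (hwa : G.Adj w a) (hva : G.Adj v a) {P : Realization G}
    (hP : P ∈ inner G s(v, w))
    (hinj : ∀ s ∈ triangle G v w a, φ s = φ P → s = P) :
    IsLoopAt (φ '' triangle G v w a) (φ P) := by
  have hc := fun {x y : V} (h : G.Adj x y) => continuous_edgePoint h
  have hT : triangle G v w a = range (edgePoint hvw) ∪ range (edgePoint hwa) ∪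
      range (edgePoint hva) := by
    simp only [triangle, edge_eq_range hvw, edge_eq_range hwa, edge_eq_range hva]
  refine ⟨?_, mem_image_of_mem φ (Or.inl (Or.inl (inner_subset_edge _ hP))), fun N hN => ?_⟩
  · rw [hT]
    exact (((isCompact_range (hc hvw)).union (isCompact_range (hc hwa))).union
      (isCompact_range (hc hva))).image hφ
  obtain ⟨t, rfl⟩ : P ∈ range (edgePoint hvw) := edge_eq_range hvw ▸ inner_subset_edge _ hP
  have ht0 : 0 < t := by
    rw [unitInterval.pos_iff_ne_zero]
    rintro rfl
    have := (hP w).2 (Sym2.mem_mk_right v w)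
    rw [edgePoint_zero, support_vertex, Finset.mem_singleton] at this
    exact hvw.ne this.symm
  have ht1 : t < 1 := by
    rw [unitInterval.lt_one_iff_ne_one]
    rintro rfl
    have := (hP v).2 (Sym2.mem_mk_left v w)
    rw [edgePoint_one, support_vertex, Finset.mem_singleton] at this
    exact hvw.ne this
  obtain ⟨l, u, ⟨hlt, htu⟩, hlu⟩ := (mem_nhds_iff_exists_Ioo_subset' ⟨0, ht0⟩ ⟨1, ht1⟩).1
    ((hφ.comp (hc hvw)).continuousAt.preimage_mem_nhds hN)
  -- The remaining arc, as two connected halves joined at the vertex `a`.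
  let R : Set (Realization G) := (edgePoint hvw '' Iic l ∪ range (edgePoint hva)) ∪
    (range (edgePoint hwa) ∪ edgePoint hvw '' Ici u)
  have hRT : R ⊆ triangle G v w a := by
    rw [hT]
    rintro s ((hs | hs) | (hs | hs))
    exacts [Or.inl (Or.inl (image_subset_range _ _ hs)), Or.inr hs, Or.inl (Or.inr hs),
      Or.inl (Or.inl (image_subset_range _ _ hs))]
  refine ⟨φ '' R, image_mono hRT, ?_, ?_, ?_, ?_⟩
  · exact (((isClosed_Iic.isCompact.image (hc hvw)).union (isCompact_range (hc hva))).union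
      ((isCompact_range (hc hwa)).union (isClosed_Ici.isCompact.image (hc hvw)))).image hφ
  · refine IsPreconnected.image ?_ φ hφ.continuousOn
    refine IsPreconnected.union (vertex G a) (Or.inr ⟨1, edgePoint_one hva⟩)
      (Or.inl ⟨1, edgePoint_one hwa⟩) ?_ ?_
    · exact IsPreconnected.union (vertex G v) ⟨0, unitInterval.nonneg', edgePoint_zero hvw⟩
        ⟨0, edgePoint_zero hva⟩ (ordConnected_Iic.isPreconnected.image _ (hc hvw).continuousOn)
        (isPreconnected_range (hc hva))
    · exact IsPreconnected.union (vertex G w) ⟨0, edgePoint_zero hwa⟩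
        ⟨1, unitInterval.le_one', edgePoint_one hvw⟩ (isPreconnected_range (hc hwa))
        (ordConnected_Ici.isPreconnected.image _ (hc hvw).continuousOn)
  · rintro ⟨s, hs, hst⟩
    obtain rfl := hinj s (hRT hs) hst
    have hva' : edgePoint hvw t ∉ range (edgePoint hva) := fun hmem => by
      rw [← edge_eq_range hva] at hmem
      have := hmem w ((hP w).2 (Sym2.mem_mk_right v w))
      simp [hvw.ne.symm, hwa.ne] at this
    have hwa' : edgePoint hvw t ∉ range (edgePoint hwa) := fun hmem => by
      rw [← edge_eq_range hwa] at hmem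
      have := hmem v ((hP v).2 (Sym2.mem_mk_left v w))
      simp [hvw.ne, hva.ne] at this
    rcases hs with (⟨s, hs, hs'⟩ | hs) | (hs | ⟨s, hs, hs'⟩)
    · exact absurd ((edgePoint_injective hvw hs').symm.trans_le hs) (not_le.2 hlt)
    · exact hva' hs
    · exact hwa' hs
    · exact absurd (le_of_le_of_eq hs (edgePoint_injective hvw hs')) (not_le.2 htu)
  · rintro _ ⟨⟨s, hs, rfl⟩, hsR⟩
    rw [hT] at hs
    rcases hs with (⟨s, rfl⟩ | hs) | hs
    · refine hlu ⟨not_le.1 fun h => hsR ?_, not_le.1 fun h => hsR ?_⟩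
      · exact ⟨_, Or.inl (Or.inl ⟨s, h, rfl⟩), rfl⟩
      · exact ⟨_, Or.inr (Or.inr ⟨s, h, rfl⟩), rfl⟩
    · exact absurd ⟨s, Or.inr (Or.inl hs), rfl⟩ hsR
    · exact absurd ⟨s, Or.inl (Or.inr hs), rfl⟩ hsR

/-! ### Crossings in a 1-drawing, and triangles through crossing edges. -/

section Crossings

variable {φ : Realization G → Sphere2}

theorem Crosses.symm {e f : Sym2 V} (h : Crosses φ e f) : Crosses φ f e :=
  ⟨h.1.symm, h.2.imp fun _ hx => ⟨hx.2, hx.1⟩⟩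

theorem IsDrawing.exists_isInvolved_of_eq (hφ : IsDrawing φ) {s t : Realization G} (hst : s ≠ t)
    (h : φ s = φ t) : ∃ e f : Sym2 V, e ≠ f ∧ IsInvolved φ e (φ s) ∧ IsInvolved φ f (φ s) ∧
      s ∈ inner G e ∧ t ∈ inner G f := by
  have hx : φ s ∈ crossings φ := ⟨s, rfl, t, h.symm, hst⟩
  obtain ⟨e, he, f, hf, hne, p, hp, q, hq, hpq⟩ := hφ.preimage_crossing _ hx
  have hp' : φ p = φ s := hpq.symm.subset (Or.inl rfl)
  have hq' : φ q = φ s := hpq.symm.subset (Or.inr rfl)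
  have hs : s = p ∨ s = q := hpq.subset (rfl : φ s = φ s)
  have ht : t = p ∨ t = q := hpq.subset h.symm
  rcases hs with rfl | rfl <;> rcases ht with rfl | rfl
  · exact absurd rfl hst
  · exact ⟨e, f, hne, ⟨he, hx, s, hp, rfl⟩, ⟨hf, hx, t, hq, h.symm⟩, hp, hq⟩
  · exact ⟨f, e, hne.symm, ⟨hf, hx, s, hq, rfl⟩, ⟨he, hx, t, hp, h.symm⟩, hq, hp⟩
  · exact absurd rfl hst

/-- The two preimages of a crossing of two given edges. -/
theorem IsDrawing.preimage_eq (hφ : IsDrawing φ) {e f : Sym2 V} (hef : e ≠ f) {x : Sphere2}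
    (he : IsInvolved φ e x) (hf : IsInvolved φ f x) :
    ∃ P ∈ inner G e, ∃ Q ∈ inner G f, φ P = x ∧ φ Q = x ∧ ∀ s, φ s = x → s = P ∨ s = Q := by
  obtain ⟨-, hx, P, hP, hPx⟩ := he
  obtain ⟨-, -, Q, hQ, hQx⟩ := hf
  have hPQ : P ≠ Q := fun h => hef (eq_of_mem_inner hP (h ▸ hQ))
  obtain ⟨-, -, -, -, -, p, -, q, -, hpq⟩ := hφ.preimage_crossing _ hx
  have hP' : P = p ∨ P = q := hpq.subset hPx
  have hQ' : Q = p ∨ Q = q := hpq.subset hQx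
  refine ⟨P, hP, Q, hQ, hPx, hQx, fun s hs => ?_⟩
  have hs' : s = p ∨ s = q := hpq.subset hs
  grind

theorem IsDrawing.eq_or_eq_of_isInvolved (hφ : IsDrawing φ) {e f g : Sym2 V} (hef : e ≠ f)
    {x : Sphere2} (he : IsInvolved φ e x) (hf : IsInvolved φ f x) (hg : IsInvolved φ g x) :
    g = e ∨ g = f := by
  obtain ⟨P, hP, Q, hQ, -, -, h⟩ := hφ.preimage_eq hef he hf
  obtain ⟨-, -, S, hS, hSx⟩ := hg
  rcases h S hSx with rfl | rfl
  exacts [Or.inl (eq_of_mem_inner hS hP), Or.inr (eq_of_mem_inner hS hQ)]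

theorem IsKDrawing.eq_of_isInvolved (hφ : IsKDrawing 1 φ) {e : Sym2 V} {x y : Sphere2}
    (hx : IsInvolved φ e x) (hy : IsInvolved φ e y) : x = y :=
  Set.encard_le_one_iff.1 (by simpa using hφ.2 e hx.1) x y hx hy

theorem IsKDrawing.eq_of_crosses (hφ : IsKDrawing 1 φ) {e f g : Sym2 V} (hf : Crosses φ e f)
    (hg : Crosses φ e g) : f = g := by
  obtain ⟨hef, x, hex, hfx⟩ := hf
  obtain ⟨heg, y, hey, hgy⟩ := hg
  obtain rfl := hφ.eq_of_isInvolved hex hey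
  exact ((hφ.1.eq_or_eq_of_isInvolved hef hex hfx hgy).resolve_left heg.symm).symm

theorem connectedComponentIn_eq_of_subset {X : Type*} [TopologicalSpace X] {D A B W E F : Set X}
    {p a b : X} (hWD : W ⊆ D \ A) (hW : IsPreconnected W) (hBW : (D ∩ B) \ {p} ⊆ W) (hE : E ⊆ A)
    (hF : F ⊆ B) (hp : p ∈ E) (ha : a ∈ (D \ E) ∩ F) (hb : b ∈ (D \ E) ∩ F) :
    connectedComponentIn (D \ E) a = connectedComponentIn (D \ E) b := by
  have hmem : ∀ c ∈ (D \ E) ∩ F, c ∈ W := fun c hc =>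
    hBW ⟨⟨hc.1.1, hF hc.2⟩, fun h => hc.1.2 (h ▸ hp)⟩
  exact connectedComponentIn_eq (hW.subset_connectedComponentIn (hmem a ha)
    (hWD.trans (sdiff_subset_sdiff_right hE)) (hmem b hb))

/-- If the edges `vw` and `xy` cross, then disjoint triangles containing them have another pair
of crossing edges. -/
theorem IsKDrawing.exists_crosses_of_triangles (hφ : IsKDrawing 1 φ) {v w a x y c : V}
    (hX : Crosses φ s(v, w) s(x, y)) (hvw : G.Adj v w) (hva : G.Adj v a) (hwa : G.Adj w a)
    (hxy : G.Adj x y) (hxc : G.Adj x c) (hyc : G.Adj y c)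
    (hd : Disjoint ({v, w, a} : Set V) {x, y, c}) :
    Crosses φ s(v, a) s(x, c) ∨ Crosses φ s(v, a) s(y, c) ∨ Crosses φ s(w, a) s(x, c) ∨
      Crosses φ s(w, a) s(y, c) := by
  by_contra hcon
  obtain ⟨hne, p, hp₁, hp₂⟩ := hX
  obtain ⟨P, hP, Q, hQ, hPp, hQp, hPQ⟩ := hφ.1.preimage_eq hne hp₁ hp₂
  have hdisj : ∀ s ∈ triangle G v w a, s ∉ triangle G x y c := fun s hs hs' => by
    obtain ⟨u, hu⟩ := support_nonempty s
    exact disjoint_left.1 hd (by simpa using mem_of_mem_triangle hs hu)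
      (by simpa using mem_of_mem_triangle hs' hu)
  have hPT : P ∈ triangle G v w a := Or.inl (Or.inl (inner_subset_edge _ hP))
  have hQT : Q ∈ triangle G x y c := Or.inl (Or.inl (inner_subset_edge _ hQ))
  have hinjP : ∀ s ∈ triangle G v w a, φ s = p → s = P := fun s hs h =>
    (hPQ s h).resolve_right fun hsQ => hdisj s hs (hsQ ▸ hQT)
  have hinjQ : ∀ s ∈ triangle G x y c, φ s = p → s = Q := fun s hs h =>
    (hPQ s h).resolve_left fun hsP => hdisj s (hsP ▸ hPT) hs
  have hA : IsLoopAt (φ '' triangle G v w a) p := hPp ▸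
    isLoopAt_image_triangle hφ.1.continuous hvw hwa hva hP (hPp.symm ▸ hinjP)
  have hB : IsLoopAt (φ '' triangle G x y c) p := hQp ▸
    isLoopAt_image_triangle hφ.1.continuous hxy hyc hxc hQ (hQp.symm ▸ hinjQ)
  have hA' : (φ '' triangle G v w a \ {p}).Nonempty := by
    refine ⟨_, mem_image_of_mem φ (vertex_mem_triangle v w a), fun h => ?_⟩
    have := (hP w).2 (Sym2.mem_mk_right v w)
    rw [← hinjP _ (vertex_mem_triangle v w a) h, support_vertex, Finset.mem_singleton] at this
    exact hvw.ne this.symm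
  have hB' : (φ '' triangle G x y c \ {p}).Nonempty := by
    refine ⟨_, mem_image_of_mem φ (vertex_mem_triangle x y c), fun h => ?_⟩
    have := (hQ y).2 (Sym2.mem_mk_right x y)
    rw [← hinjQ _ (vertex_mem_triangle x y c) h, support_vertex, Finset.mem_singleton] at this
    exact hxy.ne this.symm
  -- A common point is a crossing of one edge from each triangle. If `vw` or `xy` is involved, it is
  -- `p`, their only crossing; the other four pairs are excluded by `hcon`.
  have hAB : φ '' triangle G v w a ∩ φ '' triangle G x y c = {p} := by
    refine Subset.antisymm ?_ ?_
    · rintro _ ⟨⟨s, hs, rfl⟩, t, ht, hts⟩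
      obtain ⟨e, f, hef, he, hf, hse, htf⟩ :=
        hφ.1.exists_isInvolved_of_eq (fun h : s = t => hdisj s hs (h ▸ ht)) hts.symm
      have hcr : Crosses φ e f := ⟨hef, _, he, hf⟩
      have hse' : ∀ g, s ∈ edge G g → e = g := fun g => eq_of_mem_inner_of_mem_edge he.1 hse
      have htf' : ∀ g, t ∈ edge G g → f = g := fun g => eq_of_mem_inner_of_mem_edge hf.1 htf
      rcases hs with (hs | hs) | hs <;> obtain rfl := hse' _ hs
      · exact hφ.eq_of_isInvolved he hp₁
      all_goals
        rcases ht with (ht | ht) | ht <;> obtain rfl := htf' _ ht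
        · exact hφ.eq_of_isInvolved hf hp₂
        all_goals exact absurd hcr (by tauto)
    · rintro _ rfl
      exact ⟨hA.mem, hB.mem⟩
  obtain ⟨D, hD, hpD, hD'⟩ := hφ.1.crosses_properly p hp₁.2.1
  obtain ⟨D', hDD', hDo, hpD', ⟨W, hWD, hW, hBW⟩, W', hWD', hW', hAW'⟩ :=
    hA.exists_nhd_not_crossing hB hAB hA' hB' hD hpD
  obtain ⟨e, f, hef, he, hf, a', ha', b', hb', hab⟩ := hD' D' hDo hDD' hpD'
  have hEA : φ '' edge G s(v, w) ⊆ φ '' triangle G v w a :=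
    image_mono fun s hs => Or.inl (Or.inl hs)
  have hEB : φ '' edge G s(x, y) ⊆ φ '' triangle G x y c :=
    image_mono fun s hs => Or.inl (Or.inl hs)
  have hpA : p ∈ φ '' edge G s(v, w) := ⟨P, inner_subset_edge _ hP, hPp⟩
  have hpB : p ∈ φ '' edge G s(x, y) := ⟨Q, inner_subset_edge _ hQ, hQp⟩
  -- Proper crossing leaves open which of the two edges is removed, hence the need for both `W` and
  -- `W'`.
  rcases hφ.1.eq_or_eq_of_isInvolved hne hp₁ hp₂ he with rfl | rfl <;>
    rcases hφ.1.eq_or_eq_of_isInvolved hne hp₁ hp₂ hf with rfl | rfl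
  · exact hef rfl
  · exact hab (connectedComponentIn_eq_of_subset hWD hW hBW hEA hEB hpA ha' hb')
  · exact hab (connectedComponentIn_eq_of_subset hWD' hW' hAW' hEB hEA hpB ha' hb')
  · exact hef rfl

end Crossings

end GraphDrawing

/-! ### The combinatorics of the crossing relation. -/

namespace GraphDrawing

universe u

variable {V : Type u} {G : SimpleGraph V}

theorem exists_induce_iso_of_injective {W : Type*} {H : SimpleGraph W} (f : W → V)
    (hf : Function.Injective f) (h : ∀ i j, G.Adj (f i) (f j) ↔ H.Adj i j) :
    ∃ S : Set V, Nonempty (G.induce S ≃g H) :=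
  ⟨range f, ⟨SimpleGraph.Iso.symm ⟨Equiv.ofInjective f hf, fun {i j} => h i j⟩⟩⟩

theorem exists_induce_iso_completeGraph {n : ℕ} (f : Fin n → V)
    (h : ∀ i j, i < j → G.Adj (f i) (f j)) :
    ∃ S : Set V, Nonempty (G.induce S ≃g (⊤ : SimpleGraph (Fin n))) := by
  have hne : ∀ i j, i ≠ j → G.Adj (f i) (f j) := fun i j hij =>
    hij.lt_or_gt.elim (h i j) fun hji => (h j i hji).symm
  refine exists_induce_iso_of_injective f (fun i j hij => ?_) fun i j => ?_
  · by_contra hcon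
    exact (hne i j hcon).ne hij
  · rw [SimpleGraph.top_adj]
    exact ⟨fun hadj hij => hadj.ne (congrArg f hij), hne i j⟩

theorem exists_induce_iso_completeMultipartiteGraph {n : ℕ} (f g : Fin n → V)
    (hne : ∀ i, f i ≠ g i) (hfg : ∀ i, ¬ G.Adj (f i) (g i))
    (h : ∀ i j, i < j → G.Adj (f i) (f j) ∧ G.Adj (f i) (g j) ∧ G.Adj (g i) (f j) ∧
      G.Adj (g i) (g j)) :
    ∃ S : Set V, Nonempty
      (G.induce S ≃g SimpleGraph.completeMultipartiteGraph (fun _ : Fin n => Fin 2)) := by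
  let F : (Σ _ : Fin n, Fin 2) → V := fun x => if x.2 = 0 then f x.1 else g x.1
  have hlt : ∀ x y : Σ _ : Fin n, Fin 2, x.1 < y.1 → G.Adj (F x) (F y) := fun x y hxy => by
    obtain ⟨h1, h2, h3, h4⟩ := h _ _ hxy
    simp only [F]
    split_ifs <;> assumption
  have hadj : ∀ x y : Σ _ : Fin n, Fin 2, x.1 ≠ y.1 → G.Adj (F x) (F y) := fun x y hxy =>
    hxy.lt_or_gt.elim (hlt x y) fun hyx => (hlt y x hyx).symm
  refine exists_induce_iso_of_injective F ?_ ?_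
  · rintro ⟨i, k⟩ ⟨j, l⟩ hij
    obtain rfl : i = j := by
      by_contra hcon
      exact (hadj ⟨i, k⟩ ⟨j, l⟩ hcon).ne hij
    have := hne i
    have := (hne i).symm
    fin_cases k <;> fin_cases l <;> simp_all [F]
  · rintro ⟨i, k⟩ ⟨j, l⟩
    refine ⟨fun hij => ?_, hadj _ _⟩
    rintro (rfl : i = j)
    have h1 := hfg i
    have h2 := fun h' : G.Adj (g i) (f i) => hfg i h'.symm
    fin_cases k <;> fin_cases l <;> simp_all [F]

/-- A triangle through an edge is determined by its third vertex, and three vertices account for at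
most three triangles. -/
theorem exists_adj_of_four_le_encard {v w : V} (hvw : G.Adj v w)
    (h : 4 ≤ (trianglesThrough G s(v, w)).encard) (p q r : V) :
    ∃ z, G.Adj v z ∧ G.Adj w z ∧ z ≠ p ∧ z ≠ q ∧ z ≠ r := by
  classical
  by_contra! hcon
  have hsub : trianglesThrough G s(v, w) ⊆ ((({p, q, r} : Finset V).image
      fun z => ({v, w, z} : Finset V) : Finset (Finset V)) : Set (Finset V)) := by
    rintro T ⟨hT, hTe⟩
    have hv := hTe v (Sym2.mem_mk_left v w)
    have hw := hTe w (Sym2.mem_mk_right v w)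
    have hsub : ({v, w} : Finset V) ⊆ T := by
      intro u hu
      rcases Finset.mem_insert.1 hu with rfl | hu
      exacts [hv, Finset.mem_singleton.1 hu ▸ hw]
    obtain ⟨z, hz⟩ : ∃ z, T \ {v, w} = {z} := by
      rw [← Finset.card_eq_one, Finset.card_sdiff_of_subset hsub, hT.card_eq,
        Finset.card_pair hvw.ne]
    have hzT : z ∈ T \ {v, w} := by simp [hz]
    simp only [Finset.mem_sdiff, Finset.mem_insert, Finset.mem_singleton, not_or] at hzT
    have hTz : T = {v, w, z} := by
      rw [← Finset.sdiff_union_of_subset hsub, hz]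
      ext u
      simp only [Finset.mem_union, Finset.mem_insert, Finset.mem_singleton]
      tauto
    have h1 := hT.isClique hv hzT.1 (Ne.symm hzT.2.1)
    have h2 := hT.isClique hw hzT.1 (Ne.symm hzT.2.2)
    have h3 : z = p ∨ z = q ∨ z = r := by
      by_contra! h3
      exact h3.2.2 (hcon z h1 h2 h3.1 h3.2.1)
    simp only [Finset.coe_image, Set.mem_image, Finset.mem_coe, Finset.mem_insert,
      Finset.mem_singleton]
    exact ⟨z, h3, hTz.symm⟩
  have h1 := h.trans (Set.encard_le_encard hsub)
  rw [Set.encard_coe_eq_coe_finsetCard] at h1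
  have h2 : 4 ≤ (({p, q, r} : Finset V).image fun z => ({v, w, z} : Finset V)).card := by
    exact_mod_cast h1
  have h3 := h2.trans Finset.card_image_le
  have h4 := h3.trans Finset.card_le_three
  omega

/-- The combinatorial properties of the crossing relation `X` of a rich `1`-drawing of `G` in which
every crossed edge lies in at least four triangles. -/
structure IsRichCrossing (G : SimpleGraph V) (X : Sym2 V → Sym2 V → Prop) : Prop where
  symm {e f : Sym2 V} : X e f → X f e
  unique {e f g : Sym2 V} : X e f → X e g → f = g
  isClique {v w x y : V} : X s(v, w) s(x, y) → G.Adj v w ∧ G.Adj x y ∧ G.Adj v x ∧ G.Adj v y ∧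
    G.Adj w x ∧ G.Adj w y
  not_crossed {v w x y : V} : X s(v, w) s(x, y) → ∀ g, ¬ X s(v, x) g
  exists_crosses {v w x y a c : V} : X s(v, w) s(x, y) → G.Adj v a → G.Adj w a → G.Adj x c →
    G.Adj y c → a ≠ x → a ≠ y → c ≠ v → c ≠ w → a ≠ c →
    X s(v, a) s(x, c) ∨ X s(v, a) s(y, c) ∨ X s(w, a) s(x, c) ∨ X s(w, a) s(y, c)
  exists_adj {v w x y : V} : X s(v, w) s(x, y) → ∀ p q r : V,
    ∃ z, G.Adj v z ∧ G.Adj w z ∧ z ≠ p ∧ z ≠ q ∧ z ≠ r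

namespace IsRichCrossing

variable {X : Sym2 V → Sym2 V → Prop} {v w x y a b c d : V}

theorem swap_left {e : Sym2 V} (h : X s(v, w) e) : X s(w, v) e := by
  rwa [Sym2.eq_swap (a := w)]

theorem swap_right {e : Sym2 V} (h : X e s(x, y)) : X e s(y, x) := by
  rwa [Sym2.eq_swap (a := y)]

/-- The crossing of `vb` with `xa` makes `b` adjacent to `x` and `a`, so only the edge `yb` is
missing from a `K₆`. Its absence forces further crossings that exhaust all options for a second
triangle on `vb`. -/
theorem exists_K6_aux (hX : IsRichCrossing G X) (h : X s(v, w) s(x, y)) (hva : G.Adj v a)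
    (hwa : G.Adj w a) (hxa : G.Adj x a) (hya : G.Adj y a) (hvb : G.Adj v b) (hwb : G.Adj w b)
    (hby : b ≠ y) (hba : X s(v, b) s(x, a)) :
    ∃ S : Set V, Nonempty (G.induce S ≃g (⊤ : SimpleGraph (Fin 6))) := by
  obtain ⟨hvw, hxy, hvx, hvy, hwx, hwy⟩ := hX.isClique h
  obtain ⟨-, -, -, -, hbx, hab⟩ := hX.isClique hba
  by_cases hyb : G.Adj y b
  · refine exists_induce_iso_completeGraph ![v, w, x, y, a, b] ?_
    simp [Fin.forall_fin_succ, *, hbx.symm, hab.symm]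
  exfalso
  obtain ⟨d, hxd, hyd, hdv, hdw, hda⟩ := hX.exists_adj (hX.symm h) v w a
  have hbd : b ≠ d := fun hbd => hyb (hbd ▸ hyd)
  -- `vb` is already used by `xa`, and `wb` crossing `yd` would give the missing edge `yb`.
  have h1 : X s(w, b) s(x, d) := by
    rcases hX.exists_crosses h hvb hwb hxd hyd hbx.ne hby hdv hdw hbd with h' | h' | h' | h'
    · have := hX.unique hba h'
      simp at this
      grind [SimpleGraph.Adj.ne]
    · have := hX.unique hba h'
      simp at this
      grind [SimpleGraph.Adj.ne]
    · exact h'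
    · exact absurd (hX.isClique h').2.2.2.2.1.symm hyb
  -- `va` lies in the `K₄` of the crossing `hba`, so it is uncrossed, and `xd` is used by `wb`.
  have h2 : X s(w, a) s(y, d) := by
    rcases hX.exists_crosses h hva hwa hxd hyd hxa.ne' hya.ne' hdv hdw hda.symm with
      h' | h' | h' | h'
    · exact absurd h' (hX.not_crossed (swap_right hba) _)
    · exact absurd h' (hX.not_crossed (swap_right hba) _)
    · have := hX.unique (hX.symm h1) (hX.symm h')
      simp at this
      grind [SimpleGraph.Adj.ne]
    · exact h'
  -- The triangles `vbz` and `xaw` need a second crossing, but `xw` is uncrossed and `aw` crosses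
  -- only `yd`, which is neither `vz` nor `bz`.
  obtain ⟨z, hvz, hbz, hzw, hzx, hza⟩ := hX.exists_adj hba w x a
  have hxw : ∀ g, ¬ X g s(x, w) := fun g hg =>
    hX.not_crossed (swap_left h) g (swap_left (hX.symm hg))
  have key : ∀ u, u ≠ y → u ≠ d → ¬ X s(u, z) s(a, w) := fun u huy hud hg => by
    have := hX.unique h2 (swap_left (hX.symm hg))
    simp at this
    grind
  rcases hX.exists_crosses hba hvz hbz hwx.symm hwa.symm hzx hza hvw.ne' hwb.ne hzw with
    h' | h' | h' | h'
  · exact hxw _ h'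
  · exact key v hvy.ne hdv.symm h'
  · exact hxw _ h'
  · exact key b hby hbd h'

/-- If some vertex is adjacent to all four endvertices of two crossing edges, then there is an
induced `K₆`. -/
theorem exists_K6 (hX : IsRichCrossing G X) (h : X s(v, w) s(x, y)) (hva : G.Adj v a)
    (hwa : G.Adj w a) (hxa : G.Adj x a) (hya : G.Adj y a) :
    ∃ S : Set V, Nonempty (G.induce S ≃g (⊤ : SimpleGraph (Fin 6))) := by
  obtain ⟨b, hvb, hwb, hbx, hby, hba⟩ := hX.exists_adj h x y a
  rcases hX.exists_crosses h hvb hwb hxa hya hbx hby hva.ne' hwa.ne' hba with h' | h' | h' | h'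
  · exact hX.exists_K6_aux h hva hwa hxa hya hvb hwb hby h'
  · exact hX.exists_K6_aux (swap_right h) hva hwa hya hxa hvb hwb hbx h'
  · exact hX.exists_K6_aux (swap_left h) hwa hva hxa hya hwb hvb hby h'
  · exact hX.exists_K6_aux (swap_left (swap_right h)) hwa hva hya hxa hwb hvb hbx h'

/-- One crossing between the outer edges determines the other three: each edge is crossed once, and
the wrong choices create a common neighbour of `v`, `w`, `x`, `y`. The four crossings give all
adjacencies except `ab` and `cd`. -/
theorem exists_K2222_aux (hX : IsRichCrossing G X) (h : X s(v, w) s(x, y))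
    (hno : ∀ z, G.Adj v z → G.Adj w z → G.Adj x z → ¬ G.Adj y z)
    (hva : G.Adj v a) (hwa : G.Adj w a) (hvb : G.Adj v b) (hwb : G.Adj w b) (hab : a ≠ b)
    (hax : a ≠ x) (hay : a ≠ y) (hbx : b ≠ x) (hby : b ≠ y)
    (hxc : G.Adj x c) (hyc : G.Adj y c) (hxd : G.Adj x d) (hyd : G.Adj y d) (hcd : c ≠ d)
    (hcv : c ≠ v) (hcw : c ≠ w) (hdv : d ≠ v) (hdw : d ≠ w) (h1 : X s(v, a) s(x, c)) :
    ∃ S : Set V, Nonempty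
      (G.induce S ≃g SimpleGraph.completeMultipartiteGraph (fun _ : Fin 4 => Fin 2)) := by
  have hne : ∀ z z', G.Adj v z → G.Adj w z → G.Adj x z' → G.Adj y z' → z ≠ z' :=
    fun z z' h1 h2 h3 h4 hzz => hno z h1 h2 (hzz ▸ h3) (hzz ▸ h4)
  obtain ⟨hvw, hxy, hvx, hvy, hwx, hwy⟩ := hX.isClique h
  obtain ⟨-, -, -, hvc, hax', hac⟩ := hX.isClique h1
  have hya : ¬ G.Adj y a := hno a hva hwa hax'.symm
  have hwc : ¬ G.Adj w c := fun hwc => hno c hvc hwc hxc hyc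
  have h2 : X s(w, a) s(x, d) := by
    rcases hX.exists_crosses h hva hwa hxd hyd hax hay hdv hdw (hne _ _ hva hwa hxd hyd) with
      h' | h' | h' | h'
    · have := hX.unique h1 h'
      simp at this
      grind
    · have := hX.unique h1 h'
      simp at this
      grind [SimpleGraph.Adj.ne]
    · exact h'
    · exact absurd (hX.isClique h').2.2.2.2.1.symm hya
  have h3 : X s(v, b) s(y, c) := by
    rcases hX.exists_crosses h hvb hwb hxc hyc hbx hby hcv hcw (hne _ _ hvb hwb hxc hyc) with
      h' | h' | h' | h'
    · have := hX.unique (hX.symm h1) (hX.symm h')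
      simp at this
      grind
    · exact h'
    · have := hX.unique (hX.symm h1) (hX.symm h')
      simp at this
      grind [SimpleGraph.Adj.ne]
    · exact absurd (hX.isClique h').2.2.2.1 hwc
  have h4 : X s(w, b) s(y, d) := by
    rcases hX.exists_crosses h hvb hwb hxd hyd hbx hby hdv hdw (hne _ _ hvb hwb hxd hyd) with
      h' | h' | h' | h'
    · have := hX.unique h3 h'
      simp at this
      grind [SimpleGraph.Adj.ne]
    · have := hX.unique h3 h'
      simp at this
      grind
    · have := hX.unique (hX.symm h2) (hX.symm h')
      simp at this
      grind
    · exact h'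
  obtain ⟨-, -, -, hwd, -, had⟩ := hX.isClique h2
  obtain ⟨-, -, -, -, hby', hbc⟩ := hX.isClique h3
  obtain ⟨-, -, -, -, -, hbd⟩ := hX.isClique h4
  have hxb : ¬ G.Adj x b := fun hxb => hno b hvb hwb hxb hby'.symm
  have hvd : ¬ G.Adj v d := fun hvd => hno d hvd hwd hxd hyd
  -- Take another triangle `vaz` against `xcy`. Since `xy` crosses only `vw` and `cy` only `vb`, the
  -- second crossing forces `z = b`.
  have hab' : G.Adj a b := by
    obtain ⟨z, hvz, haz, hzw, hzx, hzc⟩ := hX.exists_adj h1 w x c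
    have hzy : z ≠ y := fun hzy => hya (hzy ▸ haz).symm
    rcases hX.exists_crosses h1 hvz haz hxy hyc.symm hzx hzc hvy.ne' hay.symm hzy with
      h' | h' | h' | h'
    · have := hX.unique (hX.symm h) (hX.symm h')
      simp at this
      grind [SimpleGraph.Adj.ne]
    · have := hX.unique (hX.symm h3) (hX.symm (swap_right h'))
      simp at this
      grind [SimpleGraph.Adj.ne]
    · have := hX.unique (hX.symm h) (hX.symm h')
      simp at this
      grind [SimpleGraph.Adj.ne]
    · have := hX.unique (hX.symm h3) (hX.symm (swap_right h'))
      simp at this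
      grind [SimpleGraph.Adj.ne]
  -- The same with `xcz` against `vaw`: `vw` crosses only `xy` and `aw` only `xd`, so `z = d`.
  have hcd' : G.Adj c d := by
    obtain ⟨z, hxz, hcz, hzv, hza, hzy⟩ := hX.exists_adj (hX.symm h1) v a y
    have hzw : z ≠ w := fun hzw => hwc (hzw ▸ hcz).symm
    rcases hX.exists_crosses (hX.symm h1) hxz hcz hvw hwa.symm hzv hza hwx.ne hcw.symm hzw with
      h' | h' | h' | h'
    · have := hX.unique h (hX.symm h')
      simp at this
      grind [SimpleGraph.Adj.ne]
    · have := hX.unique h2 (hX.symm (swap_right h'))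
      simp at this
      grind [SimpleGraph.Adj.ne]
    · have := hX.unique h (hX.symm h')
      simp at this
      grind [SimpleGraph.Adj.ne]
    · have := hX.unique h2 (hX.symm (swap_right h'))
      simp at this
      grind [SimpleGraph.Adj.ne]
  -- The non-adjacent pairs are `ay`, `bx`, `cw`, `dv`; an edge in any of them would make a common
  -- neighbour of `v`, `w`, `x`, `y`.
  refine exists_induce_iso_completeMultipartiteGraph ![a, b, c, d] ![y, x, w, v] ?_ ?_ ?_
  · simp [Fin.forall_fin_succ, *]
  · simp [Fin.forall_fin_succ, G.adj_comm a, G.adj_comm b, G.adj_comm c, G.adj_comm d, *]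
  · simp [Fin.forall_fin_succ, *, hva.symm, hwa.symm, hvb.symm, hwb.symm, hby'.symm,
      hvc.symm, hwd.symm, hxy.symm, hvw.symm, hvx.symm, hvy.symm, hwx.symm, hwy.symm]

theorem exists_K6_or_K2222 (hX : IsRichCrossing G X) (h : X s(v, w) s(x, y)) :
    (∃ S : Set V, Nonempty (G.induce S ≃g (⊤ : SimpleGraph (Fin 6)))) ∨
      ∃ S : Set V, Nonempty
        (G.induce S ≃g SimpleGraph.completeMultipartiteGraph (fun _ : Fin 4 => Fin 2)) := by
  by_cases hno : ∃ z, G.Adj v z ∧ G.Adj w z ∧ G.Adj x z ∧ G.Adj y z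
  · obtain ⟨z, h1, h2, h3, h4⟩ := hno
    exact Or.inl (hX.exists_K6 h h1 h2 h3 h4)
  right
  push Not at hno
  obtain ⟨a, hva, hwa, hax, hay, -⟩ := hX.exists_adj h x y y
  obtain ⟨b, hvb, hwb, hbx, hby, hba⟩ := hX.exists_adj h x y a
  obtain ⟨c, hxc, hyc, hcv, hcw, -⟩ := hX.exists_adj (hX.symm h) v w w
  obtain ⟨d, hxd, hyd, hdv, hdw, hdc⟩ := hX.exists_adj (hX.symm h) v w c
  have hac : a ≠ c := fun hac => hno a hva hwa (hac ▸ hxc) (hac ▸ hyc)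
  rcases hX.exists_crosses h hva hwa hxc hyc hax hay hcv hcw hac with h' | h' | h' | h'
  · exact hX.exists_K2222_aux h hno hva hwa hvb hwb hba.symm hax hay hbx hby hxc hyc hxd hyd
      hdc.symm hcv hcw hdv hdw h'
  · exact hX.exists_K2222_aux (swap_right h) (fun z h1 h2 h3 h4 => hno z h1 h2 h4 h3) hva hwa hvb
      hwb hba.symm hay hax hby hbx hyc hxc hyd hxd hdc.symm hcv hcw hdv hdw h'
  · exact hX.exists_K2222_aux (swap_left h) (fun z h1 h2 h3 h4 => hno z h2 h1 h3 h4) hwa hva hwb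
      hvb hba.symm hax hay hbx hby hxc hyc hxd hyd hdc.symm hcw hcv hdw hdv h'
  · exact hX.exists_K2222_aux (swap_left (swap_right h))
      (fun z h1 h2 h3 h4 => hno z h2 h1 h4 h3) hwa hva hwb hvb hba.symm hay hax hby hbx hyc hxc
      hyd hxd hdc.symm hcw hcv hdw hdv h'

end IsRichCrossing

theorem isRichCrossing_crosses {φ : Realization G → Sphere2} (hφ : IsKDrawing 1 φ)
    (hrich : IsRich φ) (htri : ∀ e ∈ G.edgeSet, IsCrossed φ e →
      4 ≤ (trianglesThrough G e).encard) : IsRichCrossing G (Crosses φ) := by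
  have hedge : ∀ e f, Crosses φ e f → e ∈ G.edgeSet := fun e f h => h.2.choose_spec.1.1
  have hclique : ∀ {v w x y : V}, Crosses φ s(v, w) s(x, y) → G.Adj v w ∧ G.Adj x y ∧
      G.Adj v x ∧ G.Adj v y ∧ G.Adj w x ∧ G.Adj w y := by
    intro v w x y h
    have hd := hrich.1.1 _ _ h
    obtain ⟨F⟩ := hrich.2 _ _ h
    have hadj : ∀ p ∈ s(v, w), ∀ q ∈ s(x, y), G.Adj p q := fun p hp q hq => by
      have hpq : p ≠ q := fun hpq => hd ⟨p, hp, hpq ▸ hq⟩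
      have := (F.map_adj_iff (v := ⟨p, Or.inl hp⟩) (w := ⟨q, Or.inr hq⟩)).1 (by
        rw [SimpleGraph.top_adj]
        exact fun hF => hpq (congrArg Subtype.val (F.injective hF)))
      exact this
    exact ⟨hedge _ _ h, hedge _ _ h.symm, hadj _ (by simp) _ (by simp), hadj _ (by simp) _ (by simp),
      hadj _ (by simp) _ (by simp), hadj _ (by simp) _ (by simp)⟩
  refine ⟨Crosses.symm, hφ.eq_of_crosses, hclique, ?_, ?_, ?_⟩
  · intro v w x y h g hg
    obtain ⟨hvw, hxy, hvx, hvy, hwx, hwy⟩ := hclique h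
    refine hrich.1.2 _ _ h s(v, x) hvx ?_ ?_ ?_ ⟨g, hg⟩
    · intro u hu
      rcases Sym2.mem_iff.1 hu with rfl | rfl <;> simp
    · simp [hwx.ne', hvw.ne]
    · simp [hvx.ne, hvy.ne]
  · intro v w x y a c h hva hwa hxc hyc hax hay hcv hcw hac
    obtain ⟨hvw, hxy, hvx, hvy, hwx, hwy⟩ := hclique h
    refine hφ.exists_crosses_of_triangles h hvw hva hwa hxy hxc hyc ?_
    simp [hvx.ne', hvy.ne', hwx.ne', hwy.ne', hax.symm, hay.symm, hcv, hcw, hac.symm]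
  · intro v w x y h
    exact exists_adj_of_four_le_encard (hclique h).1 (htri _ (hedge _ _ h) ⟨_, h⟩)

end GraphDrawing

end

theorem mainTheorem8 {V : Type*} (G : SimpleGraph V)
    (φ : GraphDrawing.Realization G → GraphDrawing.Sphere2)
    (hφ : GraphDrawing.IsKDrawing 1 φ) (hrich : GraphDrawing.IsRich φ)
    (hcross : (GraphDrawing.crossings φ).Nonempty)
    (htri : ∀ e ∈ G.edgeSet, GraphDrawing.IsCrossed φ e →
      4 ≤ (GraphDrawing.trianglesThrough G e).encard) :
    (∃ S : Set V, Nonempty (G.induce S ≃g (⊤ : SimpleGraph (Fin 6)))) ∨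
      ∃ S : Set V, Nonempty
        (G.induce S ≃g SimpleGraph.completeMultipartiteGraph (fun _ : Fin 4 => Fin 2)) := by
  obtain ⟨_, p, rfl, q, hq, hpq⟩ := hcross
  obtain ⟨e, f, hef, he, hf, -⟩ := hφ.1.exists_isInvolved_of_eq hpq hq.symm
  have h : GraphDrawing.Crosses φ e f := ⟨hef, _, he, hf⟩
  induction e with | _ v w => ?_
  induction f with | _ x y => ?_
  exact (GraphDrawing.isRichCrossing_crosses hφ hrich htri).exists_K6_or_K2222 h
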